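/- All graphs are finite and simple. A graph is \emph{biconnected} if it is connected (in particular, non-empty) and has no cut vertex (so $K_1$ and $K_2$ are biconnected), and \emph{chordal} if it has no induced cycle of length at least $4$. An orientation $D$ of a graph $G$ is \emph{$1$-perfect} if the out-neighborhood in $D$ of every vertex is a clique in $G$; a \emph{sink} of $D$ is a vertex of out-degree $0$. A \emph{rooted extension} of $G$ is a pair $G^v=(G,v)$ with $v\in V(G)$; it is \emph{$1$-perfectly orientable} if $G$ has a $1$-perfect orientation in which $v$ is a sink. A vertex is \emph{simplicial} if its neighborhood is a clique. The \emph{$2$-trees} are the graphs obtained from $K_2$, and the \emph{hollowed $2$-trees} are the graphs obtained from a cycle of length at least $4$, by repeatedly (zero or more times) adding a simplicial vertex of degree $2$. Let $G$ be a biconnected $K_4$-minor-free graph. Then the following statements are equivalent: \begin{enumerate} \item Some rooted extension of $G$ is $1$-perfectly orientable. \item All rooted extensions of $G$ are $1$-perfectly orientable. \item $G$ is chordal. \item $G$ is either $K_1$ or a $2$-tree. \end{enumerate} Moreover, for every $v\in V(G)$, the rooted graph $G^v$ is $1$-perfectly orientable if and only if $G$ is either $K_1$ or a $2$-tree. Furthermore,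 no hollowed $2$-tree has a $1$-perfect orientation with a sink. -/

import Mathlib

universe u v

/-- `D` is an orientation of `G`: every edge of `G` receives exactly one of its two directions,
and `D` has no other arcs (in particular, no loops). -/
structure Digraph.IsOrientationOf {V : Type u} (D : Digraph V) (G : SimpleGraph V) : Prop where
  adj_iff : ∀ x y : V, G.Adj x y ↔ D.Adj x y ∨ D.Adj y x
  asymm : ∀ x y : V, D.Adj x y → ¬ D.Adj y x

/-- A 1-perfect orientation: the out-neighborhood of every vertex is a clique in `G`. -/
structure Digraph.IsOnePerfectOrientationOf {V : Type u} (D : Digraph V) (G : SimpleGraph V) :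
    Prop extends D.IsOrientationOf G where
  isClique_out : ∀ x : V, G.IsClique {y | D.Adj x y}

/-- A sink is a vertex of out-degree zero. -/
def Digraph.IsSink {V : Type u} (D : Digraph V) (s : V) : Prop :=
  ∀ y : V, ¬ D.Adj s y

/-- A rooted graph: a graph together with one of its vertices. -/
structure RootedGraph (V : Type u) where
  graph : SimpleGraph V
  root : V

/-- A rooted graph is 1-perfectly orientable if its graph has a 1-perfect orientation in which
the root is a sink. -/
def RootedGraph.IsOnePerfectlyOrientable {V : Type u} (R : RootedGraph V) : Prop :=
  ∃ D : Digraph V, D.IsOnePerfectOrientationOf R.graph ∧ D.IsSink R.root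

namespace SimpleGraph

/-- The rooted extension of `G` with root `r`. -/
def rootedExtension {V : Type u} (G : SimpleGraph V) (r : V) : RootedGraph V where
  graph := G
  root := r

/-- `x` is a cut vertex (of a connected graph `G`): `G - x` has two vertices that are not joined
by a path. The graph without vertices is not disconnected. -/
def IsCutVertex {V : Type u} (G : SimpleGraph V) (x : V) : Prop :=
  ¬ (G.induce ({x}ᶜ : Set V)).Preconnected

/-- A graph is biconnected if it is connected and has no cut vertices. -/
structure IsBiconnected {V : Type u} (G : SimpleGraph V) : Prop where
  connected : G.Connected
  not_isCutVertex : ∀ x : V, ¬ G.IsCutVertex x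

/-- `H` is a minor of `G`: there is a minor model of `H` in `G`, that is, a family of pairwise
disjoint (nonempty) vertex sets of `G`, indexed by the vertices of `H`, each inducing a connected
subgraph, such that the sets of adjacent vertices of `H` are joined by an edge of `G`. -/
def IsMinorOf {W : Type v} {V : Type u} (H : SimpleGraph W) (G : SimpleGraph V) : Prop :=
  ∃ S : W → Set V,
    (∀ a b : W, a ≠ b → Disjoint (S a) (S b)) ∧
    (∀ a : W, (G.induce (S a)).Connected) ∧
    (∀ a b : W, H.Adj a b → ∃ x ∈ S a, ∃ y ∈ S b, G.Adj x y)

/-- `G` does not have the complete graph on four vertices as a minor. -/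
def IsK4MinorFree {V : Type u} (G : SimpleGraph V) : Prop :=
  ¬ IsMinorOf (completeGraph (Fin 4)) G

/-- A graph is chordal if it has no induced cycle of length at least four. -/
def IsChordal {V : Type u} (G : SimpleGraph V) : Prop :=
  ∀ k : ℕ, 4 ≤ k → ¬ (cycleGraph k).IsIndContained G

/-- A simplicial vertex is one whose neighborhood is a clique. -/
def IsSimplicial {V : Type u} (G : SimpleGraph V) (x : V) : Prop :=
  G.IsClique (G.neighborSet x)

/-- 2-trees: `K₂` is a 2-tree, and so is any graph `G` that is obtained from a 2-tree (`G - x`)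
by adding a simplicial vertex (`x`) of degree 2. -/
inductive IsTwoTree : ∀ {V : Type u}, SimpleGraph V → Prop
  | base {V : Type u} (G : SimpleGraph V) (h : Nonempty (G ≃g completeGraph (Fin 2))) :
      IsTwoTree G
  | step {V : Type u} (G : SimpleGraph V) (x : V) (hx : G.IsSimplicial x)
      (hdeg : (G.neighborSet x).ncard = 2) (h : IsTwoTree (G.induce ({x}ᶜ : Set V))) :
      IsTwoTree G

/-- Hollowed 2-trees: every cycle of length at least four is a hollowed 2-tree, and so is any graph
`G` that is obtained from a hollowed 2-tree (`G - x`) by adding a simplicial vertex (`x`) of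
degree 2. -/
inductive IsHollowedTwoTree : ∀ {V : Type u}, SimpleGraph V → Prop
  | base {V : Type u} (G : SimpleGraph V) (n : ℕ) (hn : 4 ≤ n) (h : Nonempty (G ≃g cycleGraph n)) :
      IsHollowedTwoTree G
  | step {V : Type u} (G : SimpleGraph V) (x : V) (hx : G.IsSimplicial x)
      (hdeg : (G.neighborSet x).ncard = 2) (h : IsHollowedTwoTree (G.induce ({x}ᶜ : Set V))) :
      IsHollowedTwoTree G

end SimpleGraph

/-!
The implications proved are 1 → 3 → 4 → 2 → 1.

*A sink forces chordality* (`IsK4MinorFree.isChordal_of_sink`). In a 1-perfect orientation a vertex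
with two out-neighbors has them adjacent. Hence all arcs of a geodesic issuing from a sink point
back to the sink, so that every other vertex of a connected graph has an out-neighbor and the sink
is unique (`Digraph.IsOnePerfectOrientationOf.exists_out_toward_sink`); and an induced cycle of
length at least four is oriented cyclically (`exists_embedding_cycleGraph_cyclic`). Let `C` be such
a cycle and `H` the component of the sink `s` in `G - C`. If a vertex `q` of `C` has a neighbor in
`H`, so has its successor on `C`: otherwise no arc leads from `q` into `H`, and the connected graph
induced by `H ∪ {q}` has the two sinks `s` and `q`. So every vertex of `C` has a neighbor in `H`,
and contracting `H` yields a wheel, which has a `K₄`-minor. Of biconnectedness, only connectedness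
is used here.

*Chordal graphs are 2-trees* (`IsChordal.isTwoTree`). A chordal graph has a simplicial vertex, by
Dirac's theorem (`IsChordal.exists_isClique_neighborSet_inter`). Unless there are fewer than three
vertices, its degree is at least two by biconnectedness and at most two as there is no `K₄`. Its
deletion preserves all hypotheses.

*2-trees are orientable towards any root* (`IsTwoTree.exists_orientation`). By induction, every edge
`pq` of a 2-tree admits a 1-perfect orientation in which `q` is a sink and the only arc from `p`
leads to `q`. If `q`, or `p`, is the vertex added last, then the orientation of the smaller 2-tree
is taken with respect to the edge between the two neighbors of that vertex.

For hollowed 2-trees (`IsHollowedTwoTree.not_isSink`), a sink on the initial cycle contradicts its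
cyclic orientation. When a vertex `x` is added, a sink other than `x` is already a sink before; and
if `x` is a sink with neighbors `a → b`, then `b` is a sink before, as its out-neighbors are adjacent
to `x`.
-/

/-! ### Geodesics -/

theorem SimpleGraph.Walk.dist_getVert_of_length_eq_dist {V : Type*} {G : SimpleGraph V} {s x : V}
    (p : G.Walk s x) (hp : p.length = G.dist s x) {i : ℕ} (hi : i ≤ p.length) :
    G.dist s (p.getVert i) = i := by
  have h1 := SimpleGraph.dist_le (p.take i)
  have h2 := SimpleGraph.dist_le (p.drop i)
  have h3 := SimpleGraph.Reachable.dist_triangle_left (p.take i).reachable x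
  rw [SimpleGraph.Walk.take_length] at h1
  rw [SimpleGraph.Walk.drop_length] at h2
  omega

/-! ### 1-perfect orientations and sinks -/

namespace Digraph

/-- The pullback of a digraph along a map of vertices. -/
def pullback {V W : Type*} (D : Digraph V) (f : W → V) : Digraph W where
  Adj a b := D.Adj (f a) (f b)

theorem IsOnePerfectOrientationOf.pullback {V W : Type u} {D : Digraph V} {G : SimpleGraph V}
    (hD : D.IsOnePerfectOrientationOf G) {H : SimpleGraph W} (f : H ↪g G) :
    (D.pullback f).IsOnePerfectOrientationOf H where
  adj_iff a b := by
    rw [← f.map_adj_iff, hD.adj_iff]; rfl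
  asymm a b := hD.asymm _ _
  isClique_out x a ha b hb hab :=
    f.map_adj_iff.1 (hD.isClique_out (f x) ha hb (f.injective.ne hab))

theorem IsOnePerfectOrientationOf.adj {V : Type u} {D : Digraph V} {G : SimpleGraph V}
    (hD : D.IsOnePerfectOrientationOf G) {x y : V} (h : D.Adj x y) : G.Adj x y :=
  (hD.adj_iff x y).2 (.inl h)

/-- Along a geodesic issuing from a sink, all arcs point back to the sink: two out-neighbors of an
inner vertex of the geodesic would be adjacent. -/
theorem IsOnePerfectOrientationOf.exists_out_toward_sink {V : Type u} {D : Digraph V}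
    {G : SimpleGraph V} (hD : D.IsOnePerfectOrientationOf G) {s : V} (hs : D.IsSink s)
    {x : V} (hx : G.Reachable s x) (hne : x ≠ s) :
    ∃ y, D.Adj x y := by
  obtain ⟨p, hp⟩ := hx.exists_walk_length_eq_dist
  have hdist := fun i hi => p.dist_getVert_of_length_eq_dist hp (i := i) hi
  have key : ∀ i, i + 1 ≤ p.length → D.Adj (p.getVert (i + 1)) (p.getVert i) := by
    intro i
    induction i with
    | zero =>
      intro hi
      rcases (hD.adj_iff _ _).1 (p.adj_getVert_succ (i := 0) (by omega)) with h | h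
      · rw [p.getVert_zero] at h
        exact absurd h (hs _)
      · exact h
    | succ i ih =>
      intro hi
      rcases (hD.adj_iff _ _).1 (p.adj_getVert_succ (i := i + 1) (by omega)) with h | h
      · exfalso
        have d0 := hdist i (by omega)
        have d2 := hdist (i + 2) (by omega)
        have hne' : p.getVert i ≠ p.getVert (i + 2) := by
          intro e; rw [e] at d0; omega
        have hadj := hD.isClique_out _ (ih (by omega)) h hne'
        have h3 := SimpleGraph.Reachable.dist_triangle_left (p.take i).reachable
          (p.getVert (i + 1 + 1))
        have h4 := SimpleGraph.dist_eq_one_iff_adj.2 hadj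
        simp only [Nat.add_assoc, Nat.reduceAdd] at *
        omega
      · exact h
  have hpos : 0 < p.length := by
    rw [hp]; exact hx.pos_dist_of_ne hne.symm
  have := key (p.length - 1) (by omega)
  rw [Nat.sub_add_cancel hpos, p.getVert_length] at this
  exact ⟨_, this⟩

end Digraph

namespace SimpleGraph

/-! ### Orientations of induced cycles -/

theorem fin_cyclic_induction {n : ℕ} {P : Fin (n + 1) → Prop} (h0 : P 0)
    (h : ∀ i, P i → P (i + 1)) (i : Fin (n + 1)) : P i := by
  induction i using Fin.induction with
  | zero => exact h0
  | succ i ih => rw [← Fin.coeSucc_eq_succ]; exact h _ ih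

theorem cycleGraph_adj_add_one {n : ℕ} (i : Fin (n + 4)) : (cycleGraph (n + 4)).Adj i (i + 1) := by
  rw [cycleGraph_adj]; right; abel

theorem cycleGraph_not_adj_add_two {n : ℕ} (i : Fin (n + 4)) :
    ¬ (cycleGraph (n + 4)).Adj i (i + 1 + 1) := by
  rw [cycleGraph_adj]
  have e1 : i - (i + 1 + 1) = -(1 + 1) := by abel
  have e2 : i + 1 + 1 - i = 1 + 1 := by abel
  rw [e1, e2, neg_eq_iff_add_eq_zero]
  have h3 : 3 % (n + 2 + 2) = 3 := Nat.mod_eq_of_lt (by omega)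
  simp [Fin.ext_iff, Fin.val_add, h3]

theorem fin_add_two_ne {n : ℕ} (i : Fin (n + 4)) : i ≠ i + 1 + 1 := by
  intro h
  have e2 : i + 1 + 1 - i = 1 + 1 := by abel
  rw [← h, sub_self] at e2
  have h2 : 2 % (n + 4) = 2 := Nat.mod_eq_of_lt (by omega)
  simp [Fin.ext_iff, Fin.val_add, h2] at e2

/-- The reflection of a cycle. -/
def cycleGraphNeg (n : ℕ) : cycleGraph (n + 4) ≃g cycleGraph (n + 4) where
  toEquiv := Equiv.neg _
  map_rel_iff' {a b} := by
    simp only [cycleGraph_adj, Equiv.neg_apply, neg_sub_neg]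
    exact or_comm

/-- A 1-perfect orientation orients every induced cycle of length at least four cyclically. After a
reflection, the cycle may be taken to be traversed in increasing order. -/
theorem exists_embedding_cycleGraph_cyclic {V : Type u} {G : SimpleGraph V} {D : Digraph V}
    (hD : D.IsOnePerfectOrientationOf G) {n : ℕ} (φ : cycleGraph (n + 4) ↪g G) :
    ∃ ψ : cycleGraph (n + 4) ↪g G, ∀ i, D.Adj (ψ i) (ψ (i + 1)) := by
  have hor : ∀ i, D.Adj (φ i) (φ (i + 1)) ∨ D.Adj (φ (i + 1)) (φ i) := fun i =>
    (hD.adj_iff _ _).1 (φ.map_adj_iff.2 (cycleGraph_adj_add_one i))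
  have hno : ∀ i, D.Adj (φ (i + 1)) (φ i) → ¬ D.Adj (φ (i + 1)) (φ (i + 1 + 1)) := fun i h h' =>
    cycleGraph_not_adj_add_two i
      (φ.map_adj_iff.1 (hD.isClique_out _ h h' (φ.injective.ne (fin_add_two_ne i))))
  rcases hor 0 with h0 | h0
  · refine ⟨φ, fun i => ?_⟩
    have := fin_cyclic_induction (P := fun i => D.Adj (φ (-i)) (φ (-i + 1))) (by simpa using h0)
      (fun i hi => ?_) (-i)
    · simpa using this
    · have e : -i = -(i + 1) + 1 := by abel
      rw [e] at hi
      exact (hor _).resolve_right fun h => hno _ h hi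
  · refine ⟨φ.comp (cycleGraphNeg n).toEmbedding, fun i => ?_⟩
    have := fin_cyclic_induction (P := fun i => D.Adj (φ (i + 1)) (φ i)) h0
      (fun i hi => (hor _).resolve_left (hno _ hi)) (-(i + 1))
    have e : -(i + 1) + 1 = -i := by abel
    rw [e] at this
    exact this

/-! ### Minors -/

theorem isMinorOf_completeGraph_four {V : Type u} {G : SimpleGraph V} {A B C E : Set V}
    (hA : (G.induce A).Connected) (hB : (G.induce B).Connected) (hC : (G.induce C).Connected)
    (hE : (G.induce E).Connected) (dAB : Disjoint A B) (dAC : Disjoint A C) (dAE : Disjoint A E)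
    (dBC : Disjoint B C) (dBE : Disjoint B E) (dCE : Disjoint C E)
    (aAB : ∃ x ∈ A, ∃ y ∈ B, G.Adj x y) (aAC : ∃ x ∈ A, ∃ y ∈ C, G.Adj x y)
    (aAE : ∃ x ∈ A, ∃ y ∈ E, G.Adj x y) (aBC : ∃ x ∈ B, ∃ y ∈ C, G.Adj x y)
    (aBE : ∃ x ∈ B, ∃ y ∈ E, G.Adj x y) (aCE : ∃ x ∈ C, ∃ y ∈ E, G.Adj x y) :
    IsMinorOf (completeGraph (Fin 4)) G := by
  have sw : ∀ {X Y : Set V}, (∃ x ∈ X, ∃ y ∈ Y, G.Adj x y) → ∃ x ∈ Y, ∃ y ∈ X, G.Adj x y :=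
    fun ⟨x, hx, y, hy, h⟩ => ⟨y, hy, x, hx, h.symm⟩
  refine ⟨![A, B, C, E], ?_, ?_, ?_⟩
  · intro a b hab
    fin_cases a <;> fin_cases b <;>
      first
        | exact absurd rfl hab
        | assumption
        | (apply Disjoint.symm; assumption)
  · intro a
    fin_cases a <;> assumption
  · intro a b hab
    have hab := hab.ne
    fin_cases a <;> fin_cases b <;>
      first
        | exact absurd rfl hab
        | assumption
        | (apply sw; assumption)

theorem connected_induce_singleton {V : Type u} (G : SimpleGraph V) (x : V) :
    (G.induce {x}).Connected := by
  have : Nonempty ({x} : Set V) := ⟨⟨x, rfl⟩⟩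
  exact Connected.of_subsingleton

/-- A `K₄`-minor-free graph has no four pairwise adjacent vertices. -/
theorem IsK4MinorFree.not_clique {V : Type u} {G : SimpleGraph V} (hG : G.IsK4MinorFree)
    {a b c d : V} (hab : G.Adj a b) (hac : G.Adj a c) (had : G.Adj a d) (hbc : G.Adj b c)
    (hbd : G.Adj b d) (hcd : G.Adj c d) : False :=
  hG <| isMinorOf_completeGraph_four (A := {a}) (B := {b}) (C := {c}) (E := {d})
    (connected_induce_singleton _ _) (connected_induce_singleton _ _)
    (connected_induce_singleton _ _) (connected_induce_singleton _ _)
    (by simpa using hab.ne) (by simpa using hac.ne) (by simpa using had.ne)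
    (by simpa using hbc.ne) (by simpa using hbd.ne) (by simpa using hcd.ne)
    ⟨_, rfl, _, rfl, hab⟩ ⟨_, rfl, _, rfl, hac⟩ ⟨_, rfl, _, rfl, had⟩ ⟨_, rfl, _, rfl, hbc⟩
    ⟨_, rfl, _, rfl, hbd⟩ ⟨_, rfl, _, rfl, hcd⟩

/-- A wheel-like configuration: if a connected set `H` sees every vertex of a cycle that avoids it,
then `H`, two consecutive vertices of the cycle, and the remaining path form a model of `K₄`. -/
theorem IsK4MinorFree.exists_not_adj_of_cycle {V : Type u} {G : SimpleGraph V}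
    (hG : G.IsK4MinorFree) {n : ℕ} (φ : cycleGraph (n + 4) ↪g G) {H : Set V}
    (hH : (G.induce H).Connected) (hφ : ∀ i, φ i ∉ H) :
    ∃ i, ∀ h ∈ H, ¬ G.Adj h (φ i) := by
  by_contra! hall
  have hmem : (2 : Fin (n + 4)) ≠ 0 ∧ (2 : Fin (n + 4)) ≠ 1 := by
    have h2 : 2 % (n + 4) = 2 := Nat.mod_eq_of_lt (by omega)
    constructor <;> simp [Fin.ext_iff, h2]
  have hlmem : Fin.last (n + 3) ≠ 0 ∧ Fin.last (n + 3) ≠ 1 := by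
    constructor <;> simp [Fin.ext_iff]
  refine hG <| isMinorOf_completeGraph_four (A := H) (B := {φ 0}) (C := {φ 1})
    (E := φ '' {i | i ≠ 0 ∧ i ≠ 1}) hH (connected_induce_singleton _ _)
    (connected_induce_singleton _ _) ?_ (by simpa using hφ 0) (by simpa using hφ 1) ?_
    (by simp) (by simp) (by simp) ?_ ?_ ?_ ⟨_, rfl, _, rfl, ?_⟩ ?_ ?_
  · have h2 : φ 2 ∈ φ '' {i | i ≠ 0 ∧ i ≠ 1} := ⟨2, hmem, rfl⟩
    have hreach : ∀ m (hm : m + 2 < n + 4), ∃ h : φ ⟨m + 2, hm⟩ ∈ φ '' {i | i ≠ 0 ∧ i ≠ 1},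
        (G.induce (φ '' {i | i ≠ 0 ∧ i ≠ 1})).Reachable ⟨_, h2⟩ ⟨_, h⟩ := by
      intro m
      induction m with
      | zero => intro hm; exact ⟨h2, Reachable.rfl⟩
      | succ m ih =>
        intro hm
        obtain ⟨h, hr⟩ := ih (by omega)
        refine ⟨⟨_, ⟨?_, ?_⟩, rfl⟩, hr.trans (Adj.reachable ?_)⟩
        · simp [Fin.ext_iff]
        · simp [Fin.ext_iff]
        · simp only [comap_adj, Function.Embedding.subtype_apply, φ.map_adj_iff]
          have e : (⟨m + 1 + 2, hm⟩ : Fin (n + 4)) = ⟨m + 2, by omega⟩ + 1 := by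
            rw [Fin.ext_iff, Fin.val_add_one_of_lt]
            simp only [Fin.lt_def, Fin.val_last]; omega
          rw [e]; exact cycleGraph_adj_add_one _
    rw [connected_iff_exists_forall_reachable]
    refine ⟨⟨_, h2⟩, ?_⟩
    rintro ⟨_, i, ⟨h0, h1⟩, rfl⟩
    have hi : i.val - 2 + 2 = i.val := by
      have h0 : i.val ≠ 0 := fun h => h0 (Fin.ext h)
      have h1 : i.val ≠ 1 := fun h => h1 (Fin.ext h)
      omega
    obtain ⟨_, hr⟩ := hreach (i.val - 2) (by omega)
    simpa only [hi] using hr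
  · rw [Set.disjoint_left]
    rintro _ hx ⟨i, -, rfl⟩
    exact hφ i hx
  · obtain ⟨h, hh, ha⟩ := hall 0; exact ⟨h, hh, _, rfl, ha⟩
  · obtain ⟨h, hh, ha⟩ := hall 1; exact ⟨h, hh, _, rfl, ha⟩
  · obtain ⟨h, hh, ha⟩ := hall 2; exact ⟨h, hh, _, ⟨2, hmem, rfl⟩, ha⟩
  · exact φ.map_adj_iff.2 (by simpa using cycleGraph_adj_add_one (0 : Fin (n + 4)))
  · refine ⟨_, rfl, _, ⟨_, hlmem, rfl⟩, φ.map_adj_iff.2 ?_⟩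
    have := (cycleGraph_adj_add_one (Fin.last (n + 3))).symm
    rwa [Fin.last_add_one] at this
  · refine ⟨_, rfl, _, ⟨2, hmem, rfl⟩, φ.map_adj_iff.2 ?_⟩
    have := cycleGraph_adj_add_one (1 : Fin (n + 4))
    rwa [show (1 : Fin (n + 4)) + 1 = 2 from rfl] at this

/-! ### Reachable sets -/

/-- The vertices that can be reached from `s` by a path all of whose vertices other than `s` lie
in `A`. -/
def reachSet {V : Type u} (G : SimpleGraph V) (A : Set V) (s : V) : Set V :=
  {y | Relation.ReflTransGen (fun a b => G.Adj a b ∧ b ∈ A) s y}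

theorem mem_reachSet_self {V : Type u} (G : SimpleGraph V) (A : Set V) (s : V) :
    s ∈ G.reachSet A s :=
  Relation.ReflTransGen.refl

theorem mem_reachSet_of_adj {V : Type u} {G : SimpleGraph V} {A : Set V} {s x y : V}
    (hx : x ∈ G.reachSet A s) (h : G.Adj x y) (hy : y ∈ A) : y ∈ G.reachSet A s :=
  Relation.ReflTransGen.tail hx ⟨h, hy⟩

theorem reachSet_subset {V : Type u} {G : SimpleGraph V} {A : Set V} {s : V} (hs : s ∈ A) :
    G.reachSet A s ⊆ A := by
  intro y hy
  rcases Relation.ReflTransGen.cases_tail hy with rfl | ⟨z, -, -, h⟩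
  · exact hs
  · exact h

theorem connected_induce_reachSet {V : Type u} (G : SimpleGraph V) (A : Set V) (s : V) :
    (G.induce (G.reachSet A s)).Connected := by
  rw [connected_iff_exists_forall_reachable]
  refine ⟨⟨s, mem_reachSet_self G A s⟩, ?_⟩
  rintro ⟨y, hy⟩
  induction hy with
  | refl => exact Reachable.rfl
  | tail hb h ih =>
    exact ih.trans (Adj.reachable (G := G.induce _) (u := ⟨_, hb⟩) (by exact h.1))

/-! ### From a sink to chordality -/

/-- In a connected `K₄`-minor-free graph, a 1-perfect orientation with a sink `s` forces chordality.
Let `C` be an induced cycle of length at least four, cyclically oriented, and let `H` be the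
component of `s` in `G - C`. If a vertex `q` of `C` has a neighbor in `H` but its successor on `C`
has none, then no arc leads from `q` into `H`, so `q` and `s` are two sinks of the connected graph
induced by `H ∪ {q}`, which is impossible. Hence every vertex of `C` has a neighbor in `H`, which
gives a `K₄`-minor. -/
theorem IsK4MinorFree.isChordal_of_sink {V : Type u} {G : SimpleGraph V} (hG : G.IsK4MinorFree)
    (hc : G.Connected) {D : Digraph V} (hD : D.IsOnePerfectOrientationOf G) {s : V}
    (hs : D.IsSink s) : G.IsChordal := by
  rintro k hk ⟨φ₀⟩
  obtain ⟨n, rfl⟩ := Nat.exists_eq_add_of_le' hk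
  obtain ⟨φ, hφ⟩ := exists_embedding_cycleGraph_cyclic hD φ₀
  set H := G.reachSet (Set.range φ)ᶜ s with hHdef
  have hsC : s ∈ (Set.range φ)ᶜ := by
    rintro ⟨i, rfl⟩
    exact hs _ (hφ i)
  have hHC : ∀ i, φ i ∉ H := fun i h => reachSet_subset hsC h ⟨i, rfl⟩
  have hH : (G.induce H).Connected := connected_induce_reachSet _ _ _
  obtain ⟨i₀, hi₀⟩ := hG.exists_not_adj_of_cycle φ hH hHC
  -- some vertex of the cycle has a neighbor in `H`
  have hstart : ∃ j, ∃ h ∈ H, G.Adj h (φ j) := by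
    obtain ⟨p⟩ := hc s (φ 0)
    obtain ⟨d, -, hd1, hd2⟩ := p.exists_boundary_dart H (mem_reachSet_self _ _ _) (hHC 0)
    by_cases hC : d.snd ∈ Set.range φ
    · obtain ⟨j, hj⟩ := hC
      exact ⟨j, d.fst, hd1, hj ▸ d.adj⟩
    · exact absurd (mem_reachSet_of_adj hd1 d.adj hC) hd2
  have hstep : ∀ j, (∃ h ∈ H, G.Adj h (φ j)) → ∃ h ∈ H, G.Adj h (φ (j + 1)) := by
    rintro j ⟨h, hh, hadj⟩
    by_contra! hno
    let B : Set V := insert (φ j) H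
    let f : G.induce B ↪g G := Embedding.induce B
    have hD' := hD.pullback f
    have hsB : s ∈ B := Or.inr (mem_reachSet_self _ _ _)
    have hjB : φ j ∈ B := Or.inl rfl
    have hreach : (G.induce B).Reachable ⟨s, hsB⟩ ⟨φ j, hjB⟩ := by
      have h1 := hH.preconnected ⟨s, mem_reachSet_self _ _ _⟩ ⟨h, hh⟩
      have h2 := h1.map (G.induceHomOfLE (Set.subset_insert (φ j) H)).toHom
      exact h2.trans (Adj.reachable (G := G.induce B) (u := ⟨h, Or.inr hh⟩) hadj)
    obtain ⟨⟨y, hy⟩, hout⟩ := hD'.exists_out_toward_sink (s := ⟨s, hsB⟩) (fun y => hs _) hreach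
      (fun e => hsC ⟨j, congrArg Subtype.val e⟩)
    change D.Adj (φ j) y at hout
    rcases hy with rfl | hy
    · exact hD.asymm _ _ hout hout
    · exact hno y hy (hD.isClique_out _ hout (hφ j) (fun e => hHC (j + 1) (e ▸ hy)))
  obtain ⟨j, hj⟩ := hstart
  have hall := fin_cyclic_induction (P := fun i => ∃ h ∈ H, G.Adj h (φ (i + j))) (by simpa using hj)
    (fun i hi => by rw [show i + 1 + j = i + j + 1 by abel]; exact hstep _ hi) (i₀ - j)
  obtain ⟨h, hh, ha⟩ := hall
  rw [sub_add_cancel] at ha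
  exact hi₀ h hh ha

/-! ### Orientations of hollowed 2-trees -/

theorem IsHollowedTwoTree.not_isSink {V : Type u} {G : SimpleGraph V} (hG : G.IsHollowedTwoTree)
    {D : Digraph V} (hD : D.IsOnePerfectOrientationOf G) (s : V) : ¬ D.IsSink s := by
  induction hG with
  | base G n hn h =>
    obtain ⟨e⟩ := h
    obtain ⟨m, rfl⟩ := Nat.exists_eq_add_of_le' hn
    obtain ⟨φ, hφ⟩ := exists_embedding_cycleGraph_cyclic hD e.symm.toEmbedding
    intro hs
    have hinj : Function.Injective (e ∘ φ) := e.injective.comp φ.injective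
    obtain ⟨i, hi⟩ := (Finite.injective_iff_surjective.1 hinj) (e s)
    exact hs _ (e.injective hi ▸ hφ i)
  | step G x hx hdeg h ih =>
    intro hs
    have hno := fun t => ih (hD.pullback (Embedding.induce ({x}ᶜ : Set _))) t
    by_cases hsx : s = x
    · subst hsx
      -- the sink is the added vertex; one of its two neighbors is then a sink of the rest
      obtain ⟨a, b, hab, hN⟩ := Set.ncard_eq_two.1 hdeg
      have key : ∀ a b, a ≠ b → G.neighborSet s = {a, b} → D.Adj a b → False := by
        intro a b hab hN hDab
        have hb : G.Adj s b := by rw [← mem_neighborSet, hN]; simp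
        have hbs : D.Adj b s := ((hD.adj_iff _ _).1 hb).resolve_left (hs _)
        refine hno ⟨b, hb.ne'⟩ ?_
        rintro ⟨y, hy⟩ (hby : D.Adj b y)
        have hsy : y ∈ G.neighborSet s := (hD.isClique_out _ hby hbs hy).symm
        rw [hN] at hsy
        rcases hsy with rfl | rfl
        · exact hD.asymm _ _ hDab hby
        · exact hD.asymm _ _ hby hby
      have hadj : G.Adj a b := hx (by rw [hN]; simp) (by rw [hN]; simp) hab
      rcases (hD.adj_iff _ _).1 hadj with h | h
      · exact key a b hab hN h
      · exact key b a hab.symm (by rw [hN, Set.pair_comm]) h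
    · exact hno ⟨s, hsx⟩ (fun y => hs _)

/-! ### Orientations of 2-trees -/

/-- Adding a simplicial vertex `x` to a 1-perfectly oriented graph: the arcs from `x` may lead to
any set `O` of neighbors of `x`, provided that the remaining neighbors, which receive an arc to
`x`, have all their out-neighbors in the neighborhood of `x`. -/
theorem exists_orientation_of_simplicial {V : Type u} {G : SimpleGraph V} {x : V}
    (hx : G.IsSimplicial x) {D' : Digraph ({x}ᶜ : Set V)}
    (hD' : D'.IsOnePerfectOrientationOf (G.induce ({x}ᶜ : Set V))) (O : Set V)
    (hO : O ⊆ G.neighborSet x)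
    (hout : ∀ u v : ({x}ᶜ : Set V), G.Adj x u → u.1 ∉ O → D'.Adj u v → G.Adj x v) :
    ∃ D : Digraph V, D.IsOnePerfectOrientationOf G ∧
      ∀ u v, D.Adj u v ↔ (∃ hu hv, D'.Adj ⟨u, hu⟩ ⟨v, hv⟩) ∨ (u = x ∧ v ∈ O) ∨
        (v = x ∧ G.Adj x u ∧ u ∉ O) := by
  refine ⟨⟨fun u v => (∃ hu hv, D'.Adj ⟨u, hu⟩ ⟨v, hv⟩) ∨ (u = x ∧ v ∈ O) ∨
        (v = x ∧ G.Adj x u ∧ u ∉ O)⟩, ⟨⟨?_, ?_⟩, ?_⟩, fun u v => Iff.rfl⟩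
  · intro u v
    by_cases hu : u = x
    · subst hu
      constructor
      · intro h
        by_cases hv : v ∈ O
        · exact .inl (.inr (.inl ⟨rfl, hv⟩))
        · exact .inr (.inr (.inr ⟨rfl, h, hv⟩))
      · rintro ((⟨h, _⟩ | ⟨-, h⟩ | ⟨-, h, -⟩) | (⟨_, h, _⟩ | ⟨rfl, h⟩ | ⟨-, h, -⟩))
        · exact absurd rfl h
        · exact hO h
        · exact absurd rfl h.ne
        · exact absurd rfl h
        · exact hO h
        · exact h
    · by_cases hv : v = x
      · subst hv
        constructor
        · intro h
          by_cases hv : u ∈ O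
          · exact .inr (.inr (.inl ⟨rfl, hv⟩))
          · exact .inl (.inr (.inr ⟨rfl, h.symm, hv⟩))
        · rintro ((⟨_, h, _⟩ | ⟨h, -⟩ | ⟨-, h, -⟩) | (⟨h, _⟩ | ⟨-, h⟩ | ⟨h, -⟩))
          · exact absurd rfl h
          · exact absurd h hu
          · exact h.symm
          · exact absurd rfl h
          · exact (hO h).symm
          · exact absurd h hu
      · have := hD'.adj_iff ⟨u, hu⟩ ⟨v, hv⟩
        simp only [comap_adj, Function.Embedding.subtype_apply] at this
        rw [this]
        constructor
        · rintro (h | h)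
          · exact .inl (.inl ⟨hu, hv, h⟩)
          · exact .inr (.inl ⟨hv, hu, h⟩)
        · rintro ((⟨_, _, h⟩ | ⟨h, -⟩ | ⟨h, -⟩) | (⟨_, _, h⟩ | ⟨h, -⟩ | ⟨h, -⟩))
          · exact .inl h
          · exact absurd h hu
          · exact absurd h hv
          · exact .inr h
          · exact absurd h hv
          · exact absurd h hu
  · rintro u v (⟨hu, hv, h⟩ | ⟨rfl, h⟩ | ⟨rfl, h, h'⟩) (⟨hv', hu', g⟩ | ⟨hg, g⟩ | ⟨hg, g, g'⟩)
    · exact hD'.asymm _ _ h g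
    · exact hv hg
    · exact hu hg
    · exact hu' rfl
    · subst hg; exact G.irrefl (hO h)
    · exact g' h
    · exact hv' rfl
    · exact h' g
    · subst hg; exact G.irrefl h
  · have hmix : ∀ u v w, (∃ hu hv, D'.Adj ⟨u, hu⟩ ⟨v, hv⟩) → w = x ∧ G.Adj x u ∧ u ∉ O →
        G.Adj v w := by
      rintro u v w ⟨hu, hv, h⟩ ⟨rfl, h1, h2⟩
      exact (hout ⟨u, hu⟩ ⟨v, hv⟩ h1 h2 h).symm
    rintro u v (h | ⟨rfl, h⟩ | h) w (g | ⟨hg, g⟩ | g) hvw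
    · obtain ⟨hu, hv, h⟩ := h
      obtain ⟨_, hw, g⟩ := g
      exact hD'.isClique_out ⟨u, hu⟩ h g (fun e => hvw (congrArg Subtype.val e))
    · obtain ⟨hu, -⟩ := h; exact absurd hg hu
    · exact hmix _ _ _ h g
    · obtain ⟨hu, -⟩ := g; exact absurd rfl hu
    · exact hx (hO h) (hO g) hvw
    · exact absurd rfl g.2.1.ne
    · exact (hmix _ _ _ g h).symm
    · subst hg; exact absurd rfl h.2.1.ne
    · exact absurd (h.1.trans g.1.symm) hvw

/-- Every edge `pq` of a 2-tree can be oriented towards a sink `q`, with no other arc leaving `p`.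
The control over the second endpoint is what allows the sink to be moved to an added vertex. -/
theorem IsTwoTree.exists_orientation {V : Type u} {G : SimpleGraph V} (hG : G.IsTwoTree) {p q : V}
    (hpq : G.Adj p q) :
    ∃ D : Digraph V, D.IsOnePerfectOrientationOf G ∧ D.IsSink q ∧ ∀ y, D.Adj p y → y = q := by
  induction hG with
  | base G h =>
    obtain ⟨e⟩ := h
    have hall : ∀ y, y = p ∨ y = q := by
      intro y
      have h1 : e p ≠ e q := e.injective.ne hpq.ne
      have : e y = e p ∨ e y = e q := by omega
      exact this.imp (fun h => e.injective h) (fun h => e.injective h)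
    refine ⟨⟨fun u v => u = p ∧ v = q⟩, ⟨⟨?_, ?_⟩, ?_⟩, ?_, fun y h => h.2⟩
    · intro u v
      constructor
      · intro h
        rcases hall u with rfl | rfl <;> rcases hall v with rfl | rfl
        · exact absurd rfl h.ne
        · exact .inl ⟨rfl, rfl⟩
        · exact .inr ⟨rfl, rfl⟩
        · exact absurd rfl h.ne
      · rintro (⟨rfl, rfl⟩ | ⟨rfl, rfl⟩)
        · exact hpq
        · exact hpq.symm
    · rintro u v ⟨rfl, rfl⟩ ⟨h, -⟩
      exact hpq.ne' h
    · rintro u v ⟨-, rfl⟩ w ⟨-, rfl⟩ h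
      exact absurd rfl h
    · rintro y ⟨h, -⟩
      exact hpq.ne' h
  | step G x hx hdeg h ih =>
    obtain ⟨a, b, hab, hN⟩ := Set.ncard_eq_two.1 hdeg
    have other : ∀ a, G.Adj x a → ∃ c, c ≠ a ∧ G.neighborSet x = {a, c} := by
      intro z hz
      have : z ∈ G.neighborSet x := hz
      rw [hN] at this
      rcases this with rfl | rfl
      · exact ⟨b, hab.symm, hN⟩
      · exact ⟨a, hab, by rw [hN, Set.pair_comm]⟩
    by_cases hp : p = x
    · subst hp
      obtain ⟨c, hcq, hN'⟩ := other q hpq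
      have hpc : G.Adj p c := by rw [← mem_neighborSet, hN']; simp
      have hcq' : G.Adj c q := hx hpc hpq hcq
      obtain ⟨D', hD', hs, ho⟩ := ih (p := ⟨c, hpc.ne'⟩) (q := ⟨q, hpq.ne'⟩) hcq'
      -- the other neighbor `c` of `p` had only the arc to `q`, so it may receive one to `p`
      obtain ⟨D, hD, hiff⟩ := exists_orientation_of_simplicial hx hD' {q}
        (by simpa using hpq) (by
          rintro ⟨u, hu⟩ v hpu huq h
          have : u ∈ G.neighborSet p := hpu
          rw [hN'] at this
          rcases this with rfl | rfl
          · exact absurd rfl huq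
          · rw [ho v h]; exact hpq)
      refine ⟨D, hD, ?_, ?_⟩
      · intro y hy
        rcases (hiff _ _).1 hy with ⟨_, _, h⟩ | ⟨h, -⟩ | ⟨-, -, h⟩
        · exact hs _ h
        · exact hpq.ne' h
        · exact h rfl
      · intro y hy
        rcases (hiff _ _).1 hy with ⟨h, _⟩ | ⟨-, h⟩ | ⟨-, h, -⟩
        · exact absurd rfl h
        · exact h
        · exact absurd rfl h.ne
    by_cases hq : q = x
    · subst hq
      obtain ⟨c, hcp, hN'⟩ := other p hpq.symm
      have hqc : G.Adj q c := by rw [← mem_neighborSet, hN']; simp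
      have hcp' : G.Adj c p := hx hqc hpq.symm hcp
      obtain ⟨D', hD', hs, ho⟩ := ih (p := ⟨c, hqc.ne'⟩) (q := ⟨p, hp⟩) hcp'
      -- `p` was a sink, and the other neighbor `c` of `q` had only the arc to `p`
      obtain ⟨D, hD, hiff⟩ := exists_orientation_of_simplicial hx hD' ∅
        (by simp) (by
          rintro ⟨u, hu⟩ v hqu - h
          have : u ∈ G.neighborSet q := hqu
          rw [hN'] at this
          rcases this with rfl | rfl
          · exact absurd h (hs _)
          · rw [ho v h]; exact hpq.symm)
      refine ⟨D, hD, ?_, ?_⟩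
      · intro y hy
        rcases (hiff _ _).1 hy with ⟨h, _⟩ | ⟨-, h⟩ | ⟨-, h, -⟩
        · exact h rfl
        · exact h
        · exact h.ne rfl
      · intro y hy
        rcases (hiff _ _).1 hy with ⟨_, _, h⟩ | ⟨h, -⟩ | ⟨h, -⟩
        · exact absurd h (hs _)
        · exact absurd h hp
        · exact h
    · obtain ⟨D', hD', hs, ho⟩ := ih (p := ⟨p, hp⟩) (q := ⟨q, hq⟩) hpq
      obtain ⟨D, hD, hiff⟩ := exists_orientation_of_simplicial hx hD' (G.neighborSet x)
        subset_rfl (fun u v h h' _ => absurd h h')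
      refine ⟨D, hD, ?_, ?_⟩
      · intro y hy
        rcases (hiff _ _).1 hy with ⟨_, _, h⟩ | ⟨h, -⟩ | ⟨-, h, h'⟩
        · exact hs _ h
        · exact hq h
        · exact h' h
      · intro y hy
        rcases (hiff _ _).1 hy with ⟨_, hv, h⟩ | ⟨h, -⟩ | ⟨-, h, h'⟩
        · exact congrArg Subtype.val (ho ⟨y, hv⟩ h)
        · exact absurd h hp
        · exact absurd h h'

theorem IsTwoTree.exists_adj {V : Type u} {G : SimpleGraph V} (hG : G.IsTwoTree) (r : V) :
    ∃ p, G.Adj p r := by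
  induction hG with
  | base G h =>
    obtain ⟨e⟩ := h
    refine ⟨e.symm (e r + 1), ?_⟩
    rw [← e.map_adj_iff, e.apply_symm_apply]
    change e r + 1 ≠ e r
    omega
  | step G x hx hdeg h ih =>
    by_cases hr : r = x
    · subst hr
      obtain ⟨a, b, -, hN⟩ := Set.ncard_eq_two.1 hdeg
      have : a ∈ G.neighborSet r := by rw [hN]; simp
      exact ⟨a, SimpleGraph.Adj.symm this⟩
    · obtain ⟨⟨p, _⟩, h⟩ := ih ⟨r, hr⟩
      exact ⟨p, h⟩

/-! ### Simplicial vertices of chordal graphs -/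

theorem cycleGraph_adj_iff_val {n : ℕ} {a b : Fin (n + 3)} :
    (cycleGraph (n + 3)).Adj a b ↔ a.val + 1 = b.val ∨ b.val + 1 = a.val ∨
      (a.val = 0 ∧ b.val = n + 2) ∨ (b.val = 0 ∧ a.val = n + 2) := by
  rw [cycleGraph_adj']
  rcases lt_trichotomy a b with h | h | h
  · have h1 := Fin.coe_sub_iff_lt.2 h
    have h2 := Fin.coe_sub_iff_le.2 h.le
    have := Fin.lt_def.1 h
    omega
  · subst h
    have h0 : (a - a).val = 0 := by simp
    omega
  · have h1 := Fin.coe_sub_iff_lt.2 h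
    have h2 := Fin.coe_sub_iff_le.2 h.le
    have := Fin.lt_def.1 h
    omega

/-- Two neighbors of `v` that both see a connected set `H` avoiding the closed neighborhood of `v`
are adjacent: otherwise `v` closes a geodesic between them through `H` to an induced cycle. -/
theorem IsChordal.adj_of_connected {V : Type u} {G : SimpleGraph V} (hG : G.IsChordal)
    {v a b : V} {H : Set V} (hH : (G.induce H).Connected) (hHv : ∀ h ∈ H, h ≠ v ∧ ¬ G.Adj v h)
    (hva : G.Adj v a) (hvb : G.Adj v b) (hab : a ≠ b) (ha : ∃ h ∈ H, G.Adj h a)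
    (hb : ∃ h ∈ H, G.Adj h b) : G.Adj a b := by
  by_contra hnab
  let K : Set V := insert a (insert b H)
  have haK : a ∈ K := .inl rfl
  have hbK : b ∈ K := .inr (.inl rfl)
  have hHK : H ⊆ K := fun h hh => .inr (.inr hh)
  have hreach : (G.induce K).Reachable ⟨a, haK⟩ ⟨b, hbK⟩ := by
    obtain ⟨h₁, hh₁, ha₁⟩ := ha
    obtain ⟨h₂, hh₂, hb₂⟩ := hb
    have h12 := (hH.preconnected ⟨h₁, hh₁⟩ ⟨h₂, hh₂⟩).map (G.induceHomOfLE hHK).toHom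
    exact ((Adj.reachable (G := G.induce K) (u := ⟨a, haK⟩) (v := ⟨h₁, hHK hh₁⟩) ha₁.symm).trans
      h12).trans (Adj.reachable (G := G.induce K) (u := ⟨h₂, hHK hh₂⟩) hb₂)
  obtain ⟨p, hp⟩ := hreach.exists_walk_length_eq_dist
  have hdist := fun i hi => p.dist_getVert_of_length_eq_dist hp (i := i) hi
  let g : ℕ → V := fun i => (p.getVert i).1
  have hg0 : g 0 = a := by simp [g]
  have hgm : g p.length = b := by simp [g]
  have hginj : ∀ i ≤ p.length, ∀ j ≤ p.length, g i = g j → i = j := by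
    intro i hi j hj h
    rw [← hdist i hi, ← hdist j hj, Subtype.ext h]
  have hgsucc : ∀ i < p.length, G.Adj (g i) (g (i + 1)) := fun i hi => p.adj_getVert_succ hi
  have hgadj : ∀ i ≤ p.length, ∀ j ≤ p.length, G.Adj (g i) (g j) ↔ (i + 1 = j ∨ j + 1 = i) := by
    intro i hi j hj
    constructor
    · intro h
      have hne : i ≠ j := by rintro rfl; exact h.ne rfl
      have h' : (G.induce K).Adj (p.getVert i) (p.getVert j) := h
      have h1 := dist_eq_one_iff_adj.2 h'
      have h2 := dist_eq_one_iff_adj.2 h'.symm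
      have h3 := (p.take i).reachable.dist_triangle_left (p.getVert j)
      have h4 := (p.take j).reachable.dist_triangle_left (p.getVert i)
      rw [hdist i hi, hdist j hj] at h3 h4
      omega
    · rintro (rfl | rfl)
      · exact hgsucc i hj
      · exact (hgsucc j hi).symm
  have hgv : ∀ i ≤ p.length, G.Adj v (g i) ↔ (i = 0 ∨ i = p.length) := by
    intro i hi
    constructor
    · intro h
      rcases (p.getVert i).2 with e | e | e
      · exact .inl (hginj i hi 0 (by omega) (by rw [hg0]; exact e))
      · exact .inr (hginj i hi _ le_rfl (by rw [hgm]; exact e))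
      · exact absurd h (hHv _ e).2
    · rintro (rfl | rfl)
      · rwa [hg0]
      · rwa [hgm]
  have hgne : ∀ i, g i ≠ v := by
    intro i h
    rcases (p.getVert i).2 with e | e | e
    · exact hva.ne (h.symm.trans e)
    · exact hvb.ne (h.symm.trans e)
    · exact (hHv _ e).1 h
  have hlen : 2 ≤ p.length := by
    by_contra! hlt
    have : p.length = 0 ∨ p.length = 1 := by omega
    rcases this with h | h
    · exact hab (by rw [← hg0, ← hgm, h])
    · exact hnab (by rw [← hg0, ← hgm, h]; exact hgsucc 0 (by omega))
  obtain ⟨m, hm⟩ := Nat.exists_eq_add_of_le' hlen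
  rw [hm] at hginj hgadj hgv
  -- the induced cycle: the `m + 3` vertices of the geodesic, followed by `v`
  refine hG (m + 4) (by omega) ⟨⟨⟨fun i => if i.val ≤ m + 2 then g i.val else v, ?_⟩, ?_⟩⟩
  · intro i j h
    dsimp only at h
    apply Fin.ext
    split_ifs at h with h1 h2 h2
    · exact hginj _ h1 _ h2 h
    · exact absurd h (hgne _)
    · exact absurd h.symm (hgne _)
    · omega
  · intro i j
    change G.Adj (if i.val ≤ m + 2 then g i.val else v) (if j.val ≤ m + 2 then g j.val else v) ↔ _
    rw [cycleGraph_adj_iff_val]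
    split_ifs with h1 h2 h2
    · rw [hgadj _ h1 _ h2]; omega
    · rw [G.adj_comm, hgv _ h1]; omega
    · rw [hgv _ h2]; omega
    · simp only [SimpleGraph.irrefl, false_iff]; omega

/-- Dirac's theorem on simplicial vertices, for the subgraph of a chordal graph induced by `A`: a
vertex `v` that misses some other vertex of `A` misses a vertex that is simplicial in `A`. In the
induction, `A` is replaced by `H ∪ S`, where `H` is a component of the non-neighbors of `v` and `S`,
a clique, is its neighborhood. -/
theorem IsChordal.exists_isClique_neighborSet_inter {V : Type u} [Finite V] {G : SimpleGraph V}
    (hG : G.IsChordal) (A : Set V) (v w : V) (hv : v ∈ A) (hw : w ∈ A) (hwv : w ≠ v)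
    (hvw : ¬ G.Adj v w) :
    ∃ z ∈ A, z ≠ v ∧ ¬ G.Adj v z ∧ G.IsClique (G.neighborSet z ∩ A) := by
  induction A using WellFoundedLT.induction generalizing v w with
  | ind A ih =>
  set T : Set V := {y | y ∈ A ∧ y ≠ v ∧ ¬ G.Adj v y} with hT
  set H := G.reachSet T w with hHdef
  have hHT : H ⊆ T := reachSet_subset ⟨hw, hwv, hvw⟩
  have hwH : w ∈ H := mem_reachSet_self _ _ _
  have hH : (G.induce H).Connected := connected_induce_reachSet _ _ _
  set S : Set V := {y | y ∈ A ∧ G.Adj v y ∧ ∃ h ∈ H, G.Adj h y} with hS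
  have hSc : ∀ a ∈ S, ∀ b ∈ S, a ≠ b → G.Adj a b := fun a ha b hb hab =>
    hG.adj_of_connected hH (fun h hh => (hHT hh).2) ha.2.1 hb.2.1 hab ha.2.2 hb.2.2
  have hBA : H ∪ S < A := by
    apply (Set.ssubset_iff_of_subset _).2
    · refine ⟨v, hv, ?_⟩
      rintro (h | h)
      · exact (hHT h).2.1 rfl
      · exact h.2.1.ne rfl
    · rintro y (h | h)
      · exact (hHT h).1
      · exact h.1
  suffices h : ∃ z ∈ H, G.IsClique (G.neighborSet z ∩ (H ∪ S)) by
    obtain ⟨z, hz, hc⟩ := h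
    refine ⟨z, (hHT hz).1, (hHT hz).2.1, (hHT hz).2.2, hc.subset ?_⟩
    rintro y ⟨hzy, hy⟩
    refine ⟨hzy, ?_⟩
    by_cases hvy : G.Adj v y
    · exact .inr ⟨hy, hvy, z, hz, hzy⟩
    · refine .inl (mem_reachSet_of_adj hz hzy ⟨hy, ?_, hvy⟩)
      rintro rfl
      exact (hHT hz).2.2 (G.adj_symm hzy)
  -- the vertex to which induction is applied is taken in `S` if possible, so that the simplicial
  -- vertex obtained cannot lie in the clique `S`
  by_cases h1 : ∃ s ∈ S, ∃ u ∈ H ∪ S, u ≠ s ∧ ¬ G.Adj s u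
  · obtain ⟨s, hs, u, hu, hus, hsu⟩ := h1
    obtain ⟨z, hz, hzs, hsz, hc⟩ := ih _ hBA s u (.inr hs) hu hus hsu
    exact ⟨z, hz.resolve_right fun h => hsz (hSc _ hs _ h hzs.symm), hc⟩
  push Not at h1
  by_cases h2 : ∃ h ∈ H, ∃ u ∈ H ∪ S, u ≠ h ∧ ¬ G.Adj h u
  · obtain ⟨h, hh, u, hu, huh, hhu⟩ := h2
    obtain ⟨z, hz, hzh, hhz, hc⟩ := ih _ hBA h u (.inl hh) hu huh hhu
    exact ⟨z, hz.resolve_right fun hzS => hhz (h1 z hzS h (.inl hh) hzh.symm).symm, hc⟩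
  push Not at h2
  refine ⟨w, hwH, ?_⟩
  rintro a ⟨-, ha⟩ b ⟨-, hb⟩ hab
  rcases ha with ha | ha
  · exact h2 a ha b hb hab.symm
  · exact h1 a ha b hb hab.symm

theorem IsChordal.exists_isSimplicial {V : Type u} [Finite V] [Nonempty V] {G : SimpleGraph V}
    (hG : G.IsChordal) : ∃ x, G.IsSimplicial x := by
  by_cases h : ∃ v w, w ≠ v ∧ ¬ G.Adj v w
  · obtain ⟨v, w, hwv, hvw⟩ := h
    obtain ⟨z, -, -, -, hc⟩ :=
      hG.exists_isClique_neighborSet_inter Set.univ v w trivial trivial hwv hvw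
    exact ⟨z, by rwa [Set.inter_univ] at hc⟩
  · push Not at h
    exact ⟨Classical.choice ‹Nonempty V›, fun a _ b _ hab => h a b hab.symm⟩

/-! ### Deleting a simplicial vertex -/

theorem IsSimplicial.preconnected_induce_diff {V : Type u} {G : SimpleGraph V} {x : V}
    (hx : G.IsSimplicial x) {A : Set V} (hA : (G.induce A).Preconnected) :
    (G.induce (A \ {x})).Preconnected := by
  rintro ⟨a, haA, hax⟩ ⟨b, hbA, hbx⟩
  have h := (reachable_iff_reflTransGen _ _).1 (hA ⟨a, haA⟩ ⟨b, hbA⟩)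
  -- a walk that enters `x` can be continued directly to any neighbor of `x`
  have key : ∀ w : A, Relation.ReflTransGen (G.induce A).Adj ⟨a, haA⟩ w →
      ∀ z : (A \ {x} : Set V), (z.1 = w.1 ∨ (w.1 = x ∧ G.Adj x z)) →
        (G.induce (A \ {x})).Reachable ⟨a, haA, hax⟩ z := by
    intro w hw
    induction hw with
    | refl =>
      rintro ⟨z, hz⟩ (rfl | ⟨rfl, -⟩)
      · exact Reachable.rfl
      · exact absurd rfl hax
    | @tail c w hac hcw ih =>
      have hcw : G.Adj c.1 w.1 := hcw
      rintro z (hz | ⟨hw, hz⟩)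
      · by_cases hcx : c.1 = x
        · exact ih z (.inr ⟨hcx, by rw [hz, ← hcx]; exact hcw⟩)
        · have h1 := ih ⟨c.1, c.2, hcx⟩ (.inl rfl)
          refine h1.trans (Adj.reachable ?_)
          change G.Adj c.1 z.1
          rwa [hz]
      · have hcx : c.1 ≠ x := fun e => hcw.ne (e.trans hw.symm)
        have h1 := ih ⟨c.1, c.2, hcx⟩ (.inl rfl)
        by_cases hcz : c.1 = z.1
        · have e : (⟨c.1, c.2, hcx⟩ : (A \ {x} : Set V)) = z := Subtype.ext hcz
          rwa [e] at h1
        · refine h1.trans (Adj.reachable ?_)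
          exact hx (show G.Adj x c.1 from hw ▸ hcw.symm) hz hcz
  exact key _ h _ (.inl rfl)

theorem IsBiconnected.induce_compl_singleton {V : Type u} [Nontrivial V] {G : SimpleGraph V}
    (hG : G.IsBiconnected) {x : V} (hx : G.IsSimplicial x) :
    (G.induce ({x}ᶜ : Set V)).IsBiconnected where
  connected := by
    obtain ⟨y, hy⟩ := exists_ne x
    have : Nonempty ({x}ᶜ : Set V) := ⟨⟨y, hy⟩⟩
    exact ⟨not_not.1 (hG.not_isCutVertex x)⟩
  not_isCutVertex := by
    intro y hy
    refine hy ?_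
    have h := hx.preconnected_induce_diff (not_not.1 (hG.not_isCutVertex y.1))
    let f : G.induce (({y.1}ᶜ : Set V) \ {x}) →g
        (G.induce ({x}ᶜ : Set V)).induce ({y}ᶜ : Set ({x}ᶜ : Set V)) :=
      ⟨fun z => ⟨⟨z.1, z.2.2⟩, fun e => z.2.1 (congrArg Subtype.val e)⟩, fun h => h⟩
    refine h.map f ?_
    rintro ⟨⟨z, hz⟩, hzy⟩
    exact ⟨⟨z, fun e => hzy (Subtype.ext e), hz⟩, rfl⟩

theorem IsK4MinorFree.induce {V : Type u} {G : SimpleGraph V} (hG : G.IsK4MinorFree) (s : Set V) :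
    (G.induce s).IsK4MinorFree := by
  rintro ⟨S, hd, hc, ha⟩
  refine hG ⟨fun i => Subtype.val '' S i, ?_, ?_, ?_⟩
  · intro a b hab
    exact (Set.disjoint_image_iff Subtype.val_injective).2 (hd a b hab)
  · intro a
    let f : (G.induce s).induce (S a) →g G.induce (Subtype.val '' S a) :=
      ⟨fun z => ⟨z.1.1, z.1, z.2, rfl⟩, fun h => h⟩
    refine (hc a).map f ?_
    rintro ⟨_, z, hz, rfl⟩
    exact ⟨⟨z, hz⟩, rfl⟩
  · intro a b hab
    obtain ⟨x, hx, y, hy, h⟩ := ha a b hab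
    exact ⟨x, ⟨x, hx, rfl⟩, y, ⟨y, hy, rfl⟩, h⟩

theorem IsChordal.induce {V : Type u} {G : SimpleGraph V} (hG : G.IsChordal) (s : Set V) :
    (G.induce s).IsChordal :=
  fun k hk ⟨φ⟩ => hG k hk ⟨(Embedding.induce s).comp φ⟩

theorem exists_adj_of_preconnected {V : Type u} {G : SimpleGraph V} (hG : G.Preconnected)
    {x y : V} (hxy : x ≠ y) : ∃ z, G.Adj x z := by
  obtain ⟨p⟩ := hG x y
  cases p with
  | nil => exact absurd rfl hxy
  | cons h _ => exact ⟨_, h⟩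

/-! ### Chordal graphs without a `K₄`-minor -/

/-- A simplicial vertex of a biconnected graph with at least three vertices has degree at least two,
and degree at most two if the graph is `K₄`-minor-free; so it can be split off. -/
theorem IsChordal.isTwoTree {V : Type u} [Finite V] {G : SimpleGraph V} (hG : G.IsChordal)
    (hb : G.IsBiconnected) (hK : G.IsK4MinorFree) :
    Nonempty (G ≃g completeGraph (Fin 1)) ∨ G.IsTwoTree := by
  induction hn : Nat.card V using Nat.strong_induction_on generalizing V with
  | _ n ih =>
  have := hb.connected.nonempty
  rcases subsingleton_or_nontrivial V with hs | hnt
  · obtain ⟨u⟩ := (unique_iff_subsingleton_and_nonempty V).2 ⟨hs, this⟩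
    exact .inl ⟨⟨Equiv.ofUnique V (Fin 1), fun {a b} => by
      constructor
      · intro h; exact absurd (Subsingleton.elim _ _) (Adj.ne h)
      · intro h; exact absurd (Subsingleton.elim _ _) h.ne⟩⟩
  right
  have h2 : 2 ≤ n := by rw [← hn]; exact Finite.one_lt_card
  rcases h2.eq_or_lt with h2 | h3
  · subst h2
    obtain ⟨x, y, hxy, hu⟩ := Nat.card_eq_two_iff.1 hn
    have hall : ∀ z, z = x ∨ z = y := fun z => by
      have : z ∈ ({x, y} : Set V) := hu ▸ trivial
      exact this
    obtain ⟨z, hz⟩ := exists_adj_of_preconnected hb.connected.preconnected hxy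
    have hadj : G.Adj x y := by
      rcases hall z with rfl | rfl
      · exact absurd rfl hz.ne
      · exact hz
    refine IsTwoTree.base G ⟨⟨Finite.equivFinOfCardEq hn, fun {a b} => ?_⟩⟩
    change (Finite.equivFinOfCardEq hn a ≠ Finite.equivFinOfCardEq hn b) ↔ _
    rw [(Finite.equivFinOfCardEq hn).injective.ne_iff]
    refine ⟨fun h => ?_, Adj.ne⟩
    rcases hall a with rfl | rfl <;> rcases hall b with rfl | rfl
    · exact absurd rfl h
    · exact hadj
    · exact hadj.symm
    · exact absurd rfl h
  · obtain ⟨x, hx⟩ := hG.exists_isSimplicial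
    obtain ⟨y, hy⟩ := exists_ne x
    obtain ⟨a, ha⟩ := exists_adj_of_preconnected hb.connected.preconnected hy.symm
    have hthird : ∃ y, y ≠ x ∧ y ≠ a := by
      by_contra! hno
      have hsub : (Set.univ : Set V) ⊆ {x, a} := fun z _ => by
        by_cases hz : z = x
        · exact .inl hz
        · exact .inr (hno z hz)
      have h4 := Set.ncard_le_ncard hsub
      rw [Set.ncard_univ, hn] at h4
      have h5 := Set.ncard_insert_le x {a}
      rw [Set.ncard_singleton] at h5
      omega
    obtain ⟨y, hyx, hya⟩ := hthird
    obtain ⟨⟨b, hba⟩, hxb⟩ := exists_adj_of_preconnected (not_not.1 (hb.not_isCutVertex a))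
      (x := ⟨x, ha.ne⟩) (y := ⟨y, hya⟩) (fun e => hyx (congrArg Subtype.val e).symm)
    have hxb : G.Adj x b := hxb
    have hab : G.Adj a b := hx ha hxb (Ne.symm hba)
    have hN : G.neighborSet x = {a, b} := by
      ext c
      constructor
      · intro hc
        by_contra hcab
        have hca : c ≠ a := fun e => hcab (.inl e)
        have hcb : c ≠ b := fun e => hcab (.inr e)
        exact hK.not_clique ha hxb hc hab (hx ha hc hca.symm) (hx hxb hc hcb.symm)
      · rintro (rfl | rfl)
        · exact ha
        · exact hxb
    refine IsTwoTree.step G x hx (by rw [hN]; exact Set.ncard_pair hab.ne) ?_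
    have hcard : Nat.card ({x}ᶜ : Set V) < n := by
      rw [← hn, Nat.card_coe_set_eq, ← Set.ncard_univ]
      exact Set.ncard_lt_ncard ⟨Set.subset_univ _, fun h => h (Set.mem_univ x) rfl⟩
    refine (ih _ hcard (hG.induce _) (hb.induce_compl_singleton hx) (hK.induce _) rfl).resolve_left
      ?_
    rintro ⟨e⟩
    have : (⟨a, ha.ne'⟩ : ({x}ᶜ : Set V)) = ⟨b, hxb.ne'⟩ := e.injective (Subsingleton.elim _ _)
    exact hab.ne (congrArg Subtype.val this)

/-! ### Rooted extensions -/

theorem isOnePerfectlyOrientable_rootedExtension {V : Type u} {G : SimpleGraph V}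
    (hG : Nonempty (G ≃g completeGraph (Fin 1)) ∨ G.IsTwoTree) (r : V) :
    (G.rootedExtension r).IsOnePerfectlyOrientable := by
  rcases hG with ⟨⟨e⟩⟩ | hG
  · have hs : ∀ x y : V, x = y := fun x y => e.injective (Subsingleton.elim _ _)
    refine ⟨⟨fun _ _ => False⟩, ⟨⟨fun x y => ?_, fun _ _ h => h.elim⟩, fun _ _ h => h.elim⟩,
      fun _ h => h⟩
    constructor
    · intro h; exact absurd (hs x y) h.ne
    · rintro (h | h) <;> exact h.elim
  · obtain ⟨p, hp⟩ := hG.exists_adj r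
    obtain ⟨D, hD, hs, -⟩ := hG.exists_orientation hp
    exact ⟨D, hD, hs⟩

end SimpleGraph

theorem mainTheorem10 {V : Type u} [Finite V] (G : SimpleGraph V) :
    (G.IsBiconnected → G.IsK4MinorFree →
      List.TFAE
        [∃ r : V, (G.rootedExtension r).IsOnePerfectlyOrientable,
         ∀ r : V, (G.rootedExtension r).IsOnePerfectlyOrientable,
         G.IsChordal,
         Nonempty (G ≃g SimpleGraph.completeGraph (Fin 1)) ∨ G.IsTwoTree] ∧
      ∀ r : V, (G.rootedExtension r).IsOnePerfectlyOrientable ↔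
        (Nonempty (G ≃g SimpleGraph.completeGraph (Fin 1)) ∨ G.IsTwoTree)) ∧
    (G.IsHollowedTwoTree →
      ¬ ∃ D : Digraph V, D.IsOnePerfectOrientationOf G ∧ ∃ s : V, D.IsSink s) := by
  refine ⟨fun hb hK => ?_, fun hG ⟨D, hD, s, hs⟩ => hG.not_isSink hD s hs⟩
  have h13 : ∀ r : V, (G.rootedExtension r).IsOnePerfectlyOrientable → G.IsChordal :=
    fun r ⟨_, hD, hs⟩ => hK.isChordal_of_sink hb.connected hD hs
  refine ⟨?_, fun r => ⟨fun h => (h13 r h).isTwoTree hb hK,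
    fun h => SimpleGraph.isOnePerfectlyOrientable_rootedExtension h r⟩⟩
  tfae_have 1 → 3 := fun ⟨r, h⟩ => h13 r h
  tfae_have 3 → 4 := fun h => h.isTwoTree hb hK
  tfae_have 4 → 2 := SimpleGraph.isOnePerfectlyOrientable_rootedExtension
  tfae_have 2 → 1 := fun h => hb.connected.nonempty.elim fun r => ⟨r, h r⟩
  tfae_finish
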